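/- Let $\mathbb{K}$ be $\mathbb{R}$ or $\mathbb{C}$, let $l_\infty$ be the Banach space of bounded $\mathbb{K}$-valued sequences with the supremum norm, and let $c_0\subset l_\infty$ be the subspace of sequences converging to $0$. An isomorphism is a linear homeomorphism. A Banach space $X$ over $\mathbb{K}$ has the nontrivial intersection property if $\bigcap_{i=1}^\infty\varphi_i^{-1}(0)\neq\{0\}$ for every countable family $(\varphi_i)$ of continuous linear functionals on $X$. Let $M\subset l_\infty$ be a linear subspace isomorphic to $c_0$. Then there exist closed linear subspaces $N\subset M$ and $H\subset l_\infty$ with $N\subset H$, and an isomorphism $T:l_\infty\to H$ (onto $H$) whose restriction $T|_{c_0}:c_0\to N$ is an isomorphism onto $N$. Moreover, the quotient Banach space $H/N$ has the nontrivial intersection property. -/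

import Mathlib

open Filter Topology

/-- The Banach space `l_∞` of bounded scalar sequences with the supremum norm. -/
abbrev EllInfty (𝕜 : Type*) [RCLike 𝕜] : Type _ := lp (fun _ : ℕ => 𝕜) ⊤

/-- The subspace `c_0` of `l_∞` of the sequences that converge to zero. -/
def cZero (𝕜 : Type*) [RCLike 𝕜] : Submodule 𝕜 (EllInfty 𝕜) where
  carrier := {x | Tendsto (fun n : ℕ => x n) atTop (𝓝 0)}
  zero_mem' := by
    simp
  add_mem' := by
    intro x y hx hy
    simpa using Tendsto.add hx hy
  smul_mem' := by
    intro c x hx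
    simpa using Tendsto.const_mul c hx

/-- The nontrivial intersection property: any countably many continuous linear functionals
have a common zero other than the origin. (A finite or empty family is covered by repeating
functionals or adding zero functionals. Only a seminorm is asked for, so that the definition
applies to a quotient before the subspace is known to be closed.) -/
def HasNIP (𝕜 X : Type*) [RCLike 𝕜] [SeminormedAddCommGroup X] [NormedSpace 𝕜 X] : Prop :=
  ∀ φ : ℕ → StrongDual 𝕜 X, (⋂ i, {x : X | φ i x = 0}) ≠ {0}

open scoped ENNReal NNReal lp

/-!
Let `J` be an isomorphism from `c₀` onto `M`. The vectors `J eₙ` form a weakly unconditionally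
Cauchy series, which in `ℓ^∞` means that the matrix of their coordinates has uniformly bounded
absolute row sums. Hence `a ↦ ∑ₙ aₙ J eₙ`, summed coordinatewise, is defined on all of `ℓ^∞`.
Since `‖J eₙ‖` stays away from zero, Rosenthal's disjointification lemma gives a subsequence along
which, in suitable rows, the diagonal entry dominates the rest of the row; along it the sum operator
`T` is bounded below. Take `H = T(ℓ^∞)` and `N = T(c₀)`, so that `H ⧸ N` is a copy of
`ℓ^∞ ⧸ c₀`.

A functional on `ℓ^∞` that vanishes on `c₀` sees only limiting behaviour, so its values at the
indicators of almost disjoint sets are absolutely summable. It therefore vanishes at all but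
countably many members of an uncountable almost disjoint family, and countably many functionals
still miss a common member.
-/

/-! ### Rosenthal's disjointification lemma -/

theorem exists_embedding_forall_offDiag_sum_le {ι : Type*} [Infinite ι] {ε : ℝ} (hε : 0 ≤ ε)
    (K : ℕ) (b : ι → ι → ℝ) (hb : ∀ i (F : Finset ι), ∑ j ∈ F, b i j ≤ K * ε) :
    ∃ f : ι ↪ ι, ∀ i (F : Finset ι), i ∉ F → ∑ j ∈ F, b (f i) (f j) ≤ ε := by
  obtain ⟨e⟩ : Nonempty (ι × ι ≃ ι) := Cardinal.eq.1 (by simp)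
  induction K generalizing b with
  | zero => exact ⟨.refl ι, fun i F _ => (hb i F).trans (by simpa using hε)⟩
  | succ K ih =>
    -- Split `ι` into the blocks `e (p, ·)`. Either some block works as it stands, or every block
    -- `p` has a row `e (p, r p)` with mass more than `ε` inside the block, and then the submatrix
    -- on these rows and columns has row sums at most `K * ε`.
    let block (p : ι) : ι ↪ ι := ⟨fun i => e (p, i), fun i j h => by simpa using h⟩
    by_cases h : ∃ p, ∀ i (F : Finset ι), i ∉ F → ∑ j ∈ F, b (block p i) (block p j) ≤ ε
    · exact h.imp' block fun _ => id
    push Not at h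
    choose r F hr hF using h
    let g : ι ↪ ι := ⟨fun p => e (p, r p), fun p q h => by simp_all⟩
    have row_sum_le (p : ι) (G : Finset ι) : ∑ q ∈ G, b (g p) (g q) ≤ K * ε := by
      have hdisj : Disjoint (G.map g) ((F p).map (block p)) := by
        simp only [Finset.disjoint_left, Finset.mem_map, not_exists, not_and]
        rintro _ ⟨q, -, rfl⟩ j hj hjq
        obtain ⟨rfl, rfl⟩ : p = q ∧ j = r q := by
          simpa [eq_comm] using e.injective hjq
        exact hr _ hj
      have hsum := hb (g p) ((G.map g).disjUnion ((F p).map (block p)) hdisj)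
      rw [Finset.sum_disjUnion, Finset.sum_map, Finset.sum_map] at hsum
      have hmass : ε < ∑ j ∈ F p, b (g p) (block p j) := hF p
      push_cast at hsum
      linarith
    obtain ⟨f, hf⟩ := ih (fun p q => b (g p) (g q)) row_sum_le
    exact ⟨f.trans g, hf⟩

/-! ### Almost disjoint families -/

theorem exists_pairwise_finite_inter :
    ∃ A : (ℕ → Bool) → Set ℕ, (∀ t, (A t).Infinite) ∧ Pairwise fun s t => (A s ∩ A t).Finite := by
  let code (t : ℕ → Bool) (n : ℕ) : ℕ := Encodable.encode (PiNat.res t n)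
  have code_eq {s t m n} (h : code s m = code t n) : m = n ∧ ∀ k < n, s k = t k := by
    have hres : PiNat.res s m = PiNat.res t n := Encodable.encode_injective h
    obtain rfl : m = n := by simpa using congrArg List.length hres
    exact ⟨rfl, fun _ hk => PiNat.res_eq_res.1 hres hk⟩
  refine ⟨fun t => Set.range (code t),
    fun t => Set.infinite_range_of_injective fun m n h => (code_eq h).1, fun s t hst => ?_⟩
  obtain ⟨k, hk⟩ := Function.ne_iff.1 hst
  refine ((Set.finite_Iic k).image (code s)).subset ?_
  rintro _ ⟨⟨m, rfl⟩, ⟨n, hn⟩⟩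
  obtain ⟨rfl, hagree⟩ := code_eq hn
  exact ⟨n, not_lt.1 fun hkn => hk (hagree k hkn).symm, rfl⟩

theorem eventually_norm_sum_mul_indicator_le {𝕜 ι α : Type*} [RCLike 𝕜] {A : ι → Set α}
    (hA : Pairwise fun i j => (A i ∩ A j).Finite) (F : Finset ι) {c : ι → 𝕜}
    (hc : ∀ i, ‖c i‖ ≤ 1) :
    ∀ᶠ x in cofinite, ‖∑ i ∈ F, c i * (A i).indicator 1 x‖ ≤ 1 := by
  have hdisj : ∀ᶠ x in cofinite, ∀ i ∈ F, ∀ j ∈ F, i ≠ j → x ∉ A i ∩ A j := by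
    simp only [eventually_all_finset, eventually_all]
    exact fun i _ j _ hij => (hA hij).compl_mem_cofinite
  filter_upwards [hdisj] with x hx
  by_cases hxF : ∃ i ∈ F, x ∈ A i
  · obtain ⟨i, hiF, hxi⟩ := hxF
    rw [Finset.sum_eq_single_of_mem i hiF]
    · simpa [hxi] using hc i
    · intro j hjF hji
      have hxj : x ∉ A j := fun hxj => hx j hjF i hiF hji ⟨hxj, hxi⟩
      simp [hxj]
  · push Not at hxF
    rw [Finset.sum_eq_zero fun i hi => by simp [hxF i hi]]
    simp

section

variable {𝕜 : Type*} [RCLike 𝕜]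

theorem sum_norm_apply_le {X ι : Type*} [AddCommGroup X] [Module 𝕜 X] (φ : X →ₗ[𝕜] 𝕜) (v : ι → X)
    (F : Finset ι) {C : ℝ} (h : ∀ c : ι → 𝕜, (∀ i, ‖c i‖ = 1) → ‖φ (∑ i ∈ F, c i • v i)‖ ≤ C) :
    ∑ i ∈ F, ‖φ (v i)‖ ≤ C := by
  choose c hc hcv using fun i => RCLike.exists_norm_eq_mul_self (φ (v i))
  have hsum : φ (∑ i ∈ F, c i • v i) = ((∑ i ∈ F, ‖φ (v i)‖ : ℝ) : 𝕜) := by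
    simp only [map_sum, map_smul, smul_eq_mul, ← hcv]
  calc ∑ i ∈ F, ‖φ (v i)‖ ≤ |∑ i ∈ F, ‖φ (v i)‖| := le_abs_self _
    _ = ‖φ (∑ i ∈ F, c i • v i)‖ := by rw [hsum, RCLike.norm_ofReal]
    _ ≤ C := h c hc

/-! ### The spaces `ℓ^∞` and `c₀` -/

theorem exists_lt_norm_apply {ι : Type*} {a : ℓ^∞(ι, 𝕜)} {r : ℝ} (hr : 0 ≤ r) (ha : r < ‖a‖) :
    ∃ k, r < ‖a k‖ := by
  contrapose! ha
  exact lp.norm_le_of_forall_le hr ha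

theorem sum_smul_single_apply {ι : Type*} [DecidableEq ι] (F : Finset ι) (c : ι → 𝕜) (k : ι) :
    (∑ i ∈ F, c i • (lp.single ∞ i (1 : 𝕜) : ℓ^∞(ι, 𝕜))) k = if k ∈ F then c k else 0 := by
  rw [lp.coeFn_sum, Finset.sum_apply]
  simp [Pi.single_apply]

theorem mem_cZero {x : EllInfty 𝕜} : x ∈ cZero 𝕜 ↔ Tendsto (fun n : ℕ => x n) atTop (𝓝 0) :=
  Iff.rfl

theorem isClosed_cZero : IsClosed (cZero 𝕜 : Set (EllInfty 𝕜)) := by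
  refine isClosed_of_closure_subset fun x hx => ?_
  rw [SetLike.mem_coe, mem_cZero, NormedAddGroup.tendsto_nhds_zero]
  intro ε hε
  obtain ⟨y, hy, hxy⟩ := Metric.mem_closure_iff.1 hx (ε / 2) (half_pos hε)
  rw [dist_eq_norm] at hxy
  filter_upwards [NormedAddGroup.tendsto_nhds_zero.1 (mem_cZero.1 hy) (ε / 2) (half_pos hε)]
    with n hn
  calc ‖x n‖ = ‖(x - y) n + y n‖ := by simp
    _ ≤ ‖x - y‖ + ‖y n‖ := norm_add_le_of_le (lp.norm_apply_le_norm ENNReal.top_ne_zero _ n) le_rfl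
    _ < ε := by linarith

instance : CompleteSpace (cZero 𝕜) := isClosed_cZero.completeSpace_coe

variable (𝕜) in
/-- The `n`-th unit vector of `c₀`. -/
noncomputable def cZero.single (n : ℕ) : cZero 𝕜 :=
  ⟨lp.single ∞ n 1, mem_cZero.2 <| tendsto_const_nhds.congr' <| by
    filter_upwards [eventually_ne_atTop n] with k hk
    simp [hk]⟩

@[simp]
theorem cZero.coe_single (n : ℕ) : (cZero.single 𝕜 n : EllInfty 𝕜) = lp.single ∞ n 1 :=
  rfl

theorem cZero.norm_sum_smul_single_le (F : Finset ℕ) {c : ℕ → 𝕜} (hc : ∀ i, ‖c i‖ ≤ 1) :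
    ‖∑ i ∈ F, c i • cZero.single 𝕜 i‖ ≤ 1 := by
  rw [← Submodule.norm_coe]
  refine lp.norm_le_of_forall_le zero_le_one fun k => ?_
  simp only [Submodule.coe_sum, Submodule.coe_smul, coe_single, sum_smul_single_apply]
  split_ifs <;> simp [hc k]

theorem hasSum_smul_single {a : EllInfty 𝕜} (ha : a ∈ cZero 𝕜) :
    HasSum (fun n => a n • (lp.single ∞ n (1 : 𝕜) : EllInfty 𝕜)) a := by
  rw [HasSum, SummationFilter.unconditional_filter, Metric.tendsto_atTop]
  intro ε hε
  obtain ⟨N, hN⟩ := Metric.tendsto_atTop.1 (mem_cZero.1 ha) (ε / 2) (half_pos hε)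
  refine ⟨Finset.range N, fun F hF => ?_⟩
  rw [dist_eq_norm]
  refine (lp.norm_le_of_forall_le (half_pos hε).le fun k => ?_).trans_lt (half_lt_self hε)
  rw [lp.coeFn_sub, Pi.sub_apply, sum_smul_single_apply]
  split_ifs with hk
  · simpa using (half_pos hε).le
  · have hNk : N ≤ k := not_lt.1 fun h => hk (hF (Finset.mem_range.2 h))
    simpa using (hN k hNk).le

theorem not_tendsto_map_single {E : Type*} [NormedAddCommGroup E] [NormedSpace 𝕜 E]
    (e : cZero 𝕜 ≃L[𝕜] E) : ¬ Tendsto (fun n => e (cZero.single 𝕜 n)) atTop (𝓝 0) := by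
  intro h
  have hsingle : Tendsto (fun n => ‖cZero.single 𝕜 n‖) atTop (𝓝 0) := by
    simpa using ((e.symm.continuous.tendsto 0).comp h).norm
  have hnorm (n : ℕ) : ‖cZero.single 𝕜 n‖ = 1 := by
    rw [← Submodule.norm_coe, cZero.coe_single, lp.norm_single ENNReal.zero_lt_top, norm_one]
  simp [hnorm] at hsingle

/-! ### The nontrivial intersection property of `ℓ^∞ ⧸ c₀` -/

theorem norm_apply_le_of_eventually_norm_le {φ : StrongDual 𝕜 (EllInfty 𝕜)}
    (hφ : ∀ x ∈ cZero 𝕜, φ x = 0) {y : EllInfty 𝕜} {C : ℝ} (hC : 0 ≤ C)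
    (hy : ∀ᶠ n in atTop, ‖y n‖ ≤ C) : ‖φ y‖ ≤ ‖φ‖ * C := by
  obtain ⟨N, hN⟩ := eventually_atTop.1 hy
  have htail (n : ℕ) : ‖(Set.Ici N).indicator y n‖ ≤ C := by
    by_cases hn : n ∈ Set.Ici N
    · simpa [hn] using hN n hn
    · simpa [hn] using hC
  let z : EllInfty 𝕜 := ⟨(Set.Ici N).indicator y, memℓp_infty ⟨C, Set.forall_mem_range.2 htail⟩⟩
  have hyz : y - z ∈ cZero 𝕜 := by
    refine tendsto_const_nhds.congr' ?_
    filter_upwards [eventually_ge_atTop N] with n hn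
    change 0 = y n - (Set.Ici N).indicator y n
    simp [hn]
  calc ‖φ y‖ = ‖φ z‖ := by rw [sub_eq_zero.1 ((map_sub φ y z).symm.trans (hφ _ hyz))]
    _ ≤ ‖φ‖ * C := φ.le_opNorm_of_le (lp.norm_le_of_forall_le hC htail)

variable (𝕜) in
/-- The indicator sequence of a set of natural numbers, as an element of `ℓ^∞`. -/
noncomputable def EllInfty.indicator (A : Set ℕ) : EllInfty 𝕜 :=
  ⟨A.indicator 1, memℓp_infty ⟨1, Set.forall_mem_range.2 fun n => by
    by_cases hn : n ∈ A <;> simp [hn]⟩⟩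

@[simp]
theorem EllInfty.coe_indicator (A : Set ℕ) : ⇑(EllInfty.indicator 𝕜 A) = A.indicator 1 :=
  rfl

theorem EllInfty.indicator_notMem_cZero {A : Set ℕ} (hA : A.Infinite) :
    EllInfty.indicator 𝕜 A ∉ cZero 𝕜 := by
  intro h
  have hlt := NormedAddGroup.tendsto_nhds_zero.1 (mem_cZero.1 h) 1 one_pos
  obtain ⟨n, hnA, hn⟩ := ((Nat.frequently_atTop_iff_infinite.2 hA).and_eventually hlt).exists
  simp [show n ∈ A from hnA] at hn

theorem countable_setOf_apply_indicator_ne_zero {ι : Type*} {A : ι → Set ℕ}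
    (hA : Pairwise fun i j => (A i ∩ A j).Finite) {φ : StrongDual 𝕜 (EllInfty 𝕜)}
    (hφ : ∀ x ∈ cZero 𝕜, φ x = 0) : {i | φ (EllInfty.indicator 𝕜 (A i)) ≠ 0}.Countable := by
  have hsum : Summable fun i => ‖φ (EllInfty.indicator 𝕜 (A i))‖ := by
    refine summable_of_sum_le (c := ‖φ‖ * 1) (fun _ => norm_nonneg _) fun F => ?_
    refine sum_norm_apply_le (φ : EllInfty 𝕜 →ₗ[𝕜] 𝕜) _ F fun c hc => ?_
    refine norm_apply_le_of_eventually_norm_le hφ zero_le_one ?_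
    rw [← Nat.cofinite_eq_atTop, lp.coeFn_sum]
    simp only [Finset.sum_apply]
    exact eventually_norm_sum_mul_indicator_le hA F fun i => (hc i).le
  simpa [Function.support] using hsum.countable_support

theorem exists_notMem_cZero_forall_apply_eq_zero {φ : ℕ → StrongDual 𝕜 (EllInfty 𝕜)}
    (hφ : ∀ i, ∀ x ∈ cZero 𝕜, φ i x = 0) : ∃ y ∉ cZero 𝕜, ∀ i, φ i y = 0 := by
  obtain ⟨A, hAinf, hA⟩ := exists_pairwise_finite_inter
  let s : Set (ℕ → Bool) := ⋃ i, {t | φ i (EllInfty.indicator 𝕜 (A t)) ≠ 0}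
  have hs : s.Countable :=
    Set.countable_iUnion fun i => countable_setOf_apply_indicator_ne_zero hA (hφ i)
  have : Uncountable (ℕ → Bool) := by
    simp [← Cardinal.aleph0_lt_mk_iff, Cardinal.aleph0_lt_continuum]
  obtain ⟨t, ht⟩ : ∃ t, t ∉ s :=
    (Set.ne_univ_iff_exists_notMem s).1 fun huniv => Set.not_countable_univ (huniv ▸ hs)
  exact ⟨_, EllInfty.indicator_notMem_cZero (hAinf t), by simpa [s] using ht⟩

theorem hasNIP_quotient_cZero : HasNIP 𝕜 (EllInfty 𝕜 ⧸ cZero 𝕜) := by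
  intro φ hφ
  obtain ⟨y, hy, hφy⟩ := exists_notMem_cZero_forall_apply_eq_zero
    (φ := fun i => φ i ∘L (cZero 𝕜).mkQL) fun i x hx => by
      simp [(Submodule.Quotient.mk_eq_zero _).2 hx]
  have hmem : (cZero 𝕜).mkQ y ∈ ⋂ i, {x | φ i x = 0} := Set.mem_iInter.2 hφy
  rw [hφ, Set.mem_singleton_iff, Submodule.mkQ_apply, Submodule.Quotient.mk_eq_zero] at hmem
  exact hy hmem

theorem HasNIP.of_injective {X Y : Type*} [SeminormedAddCommGroup X] [NormedSpace 𝕜 X]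
    [SeminormedAddCommGroup Y] [NormedSpace 𝕜 Y] (hX : HasNIP 𝕜 X) (f : X →L[𝕜] Y)
    (hf : Function.Injective f) : HasNIP 𝕜 Y := by
  intro φ hφ
  refine hX (fun i => φ i ∘L f) (Set.ext fun x => ?_)
  calc x ∈ ⋂ i, {x | (φ i ∘L f) x = 0} ↔ f x ∈ ⋂ i, {y | φ i y = 0} := by simp
    _ ↔ x ∈ ({0} : Set X) := by rw [hφ]; simp [map_eq_zero_iff f hf]

theorem HasNIP.quotient_of_comap_eq {E F : Type*} [SeminormedAddCommGroup E] [NormedSpace 𝕜 E]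
    [SeminormedAddCommGroup F] [NormedSpace 𝕜 F] {P : Submodule 𝕜 E} {Q : Submodule 𝕜 F}
    (hP : HasNIP 𝕜 (E ⧸ P)) (T : E →L[𝕜] F) (hT : Q.comap (T : E →ₗ[𝕜] F) = P) :
    HasNIP 𝕜 (F ⧸ Q) := by
  have hker : (Q.mkQL ∘L T : E →L[𝕜] F ⧸ Q).ker = P := by
    rw [← hT]
    ext x
    simp
  refine hP.of_injective (P.liftQL (Q.mkQL ∘L T) hker.ge) (LinearMap.ker_eq_bot.1 ?_)
  exact Submodule.ker_liftQ_eq_bot _ _ hker.ge hker.le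

/-! ### Weakly unconditionally Cauchy series in `ℓ^∞` -/

section RowSums

variable {γ ι : Type*} {w : γ → ℓ^∞(ι, 𝕜)} {C : ℝ≥0}

theorem norm_apply_mul_le (a : ℓ^∞(γ, 𝕜)) (u : γ → 𝕜) (m : γ) : ‖a m * u m‖ ≤ ‖a‖ * ‖u m‖ :=
  norm_mul_le_of_le (lp.norm_apply_le_norm ENNReal.top_ne_zero a m) le_rfl

theorem summable_mul_of_sum_norm_le {u : γ → 𝕜} {c : ℝ} (hu : ∀ F : Finset γ, ∑ m ∈ F, ‖u m‖ ≤ c)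
    (a : ℓ^∞(γ, 𝕜)) : Summable fun m => a m * u m :=
  .of_norm_bounded ((summable_of_sum_le (fun _ => norm_nonneg _) hu).mul_left ‖a‖)
    (norm_apply_mul_le a u)

theorem norm_tsum_mul_le {u : γ → 𝕜} {c : ℝ} (hu : ∀ F : Finset γ, ∑ m ∈ F, ‖u m‖ ≤ c)
    (a : ℓ^∞(γ, 𝕜)) : ‖∑' m, a m * u m‖ ≤ c * ‖a‖ := by
  have hsum : Summable fun m => ‖u m‖ := summable_of_sum_le (fun _ => norm_nonneg _) hu
  calc ‖∑' m, a m * u m‖ ≤ ‖a‖ * ∑' m, ‖u m‖ :=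
        tsum_of_norm_bounded (hsum.hasSum.mul_left ‖a‖) (norm_apply_mul_le a u)
    _ ≤ c * ‖a‖ := by
        rw [mul_comm]
        gcongr
        exact hsum.tsum_le_of_sum_le hu

theorem norm_tsum_mul_sub_le {u : γ → 𝕜} {c ε : ℝ} (hu : ∀ F : Finset γ, ∑ m ∈ F, ‖u m‖ ≤ c)
    {n : γ} (hn : ∀ F : Finset γ, n ∉ F → ∑ m ∈ F, ‖u m‖ ≤ ε) (a : ℓ^∞(γ, 𝕜)) :
    ‖∑' m, a m * u m - a n * u n‖ ≤ ε * ‖a‖ := by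
  classical
  have hoff : ∑' m, a m * u m - a n * u n = ∑' m, a m * Function.update u n 0 m := by
    rw [(summable_mul_of_sum_norm_le hu a).tsum_eq_add_tsum_ite n, add_sub_cancel_left]
    simp [Function.update_apply]
  rw [hoff]
  refine norm_tsum_mul_le (fun F => ?_) a
  calc ∑ m ∈ F, ‖Function.update u n 0 m‖ = ∑ m ∈ F.erase n, ‖u m‖ := by
        simp [Function.update_apply, apply_ite norm, Finset.sum_ite, Finset.filter_ne']
    _ ≤ ε := hn _ (Finset.notMem_erase n F)

/-- The absolute row sums of the matrix `(k, m) ↦ w m k` are at most `C`. This is the condition that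
the series `∑ w m` be weakly unconditionally Cauchy in `ℓ^∞`, with constant `C`; it is phrased with
finite sums so that it includes the summability of the rows. -/
def RowSumsLE (w : γ → ℓ^∞(ι, 𝕜)) (C : ℝ≥0) : Prop :=
  ∀ k (F : Finset γ), ∑ m ∈ F, ‖w m k‖ ≤ C

theorem rowSumsLE_map_single (J : cZero 𝕜 →L[𝕜] ℓ^∞(ι, 𝕜)) :
    RowSumsLE (fun m => J (cZero.single 𝕜 m)) ‖J‖₊ := by
  intro k F
  refine sum_norm_apply_le (lp.evalCLM 𝕜 (fun _ : ι => 𝕜) ∞ k ∘L J : cZero 𝕜 →ₗ[𝕜] 𝕜)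
    (cZero.single 𝕜) F fun c hc => ?_
  calc ‖J (∑ i ∈ F, c i • cZero.single 𝕜 i) k‖ ≤ ‖J (∑ i ∈ F, c i • cZero.single 𝕜 i)‖ :=
        lp.norm_apply_le_norm ENNReal.top_ne_zero _ k
    _ ≤ ‖J‖ := J.unit_le_opNorm _ (cZero.norm_sum_smul_single_le F fun i => (hc i).le)

namespace RowSumsLE

theorem comp_embedding (hw : RowSumsLE w C) {δ : Type*} (f : δ ↪ γ) :
    RowSumsLE (fun m => w (f m)) C :=
  fun k F => by simpa using hw k (F.map f)

/-- The operator `a ↦ ∑ₘ aₘ wₘ` on `ℓ^∞`. The sum is taken in each coordinate separately, since the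
series need not converge in norm for `a ∉ c₀`. -/
noncomputable def sumOperator (hw : RowSumsLE w C) : ℓ^∞(γ, 𝕜) →L[𝕜] ℓ^∞(ι, 𝕜) :=
  LinearMap.mkContinuous
    { toFun a := ⟨fun k => ∑' m, a m * w m k,
        memℓp_infty ⟨C * ‖a‖, Set.forall_mem_range.2 fun k => norm_tsum_mul_le (hw k) a⟩⟩
      map_add' a b := by
        ext k
        change ∑' m, (a m + b m) * w m k = ∑' m, a m * w m k + ∑' m, b m * w m k
        simp only [add_mul]
        exact (summable_mul_of_sum_norm_le (hw k) a).tsum_add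
          (summable_mul_of_sum_norm_le (hw k) b)
      map_smul' c a := by
        ext k
        simp [mul_assoc, tsum_mul_left] }
    C fun a => lp.norm_le_of_forall_le (by positivity) fun k => norm_tsum_mul_le (hw k) a

theorem sumOperator_apply (hw : RowSumsLE w C) (a : ℓ^∞(γ, 𝕜)) (k : ι) :
    hw.sumOperator a k = ∑' m, a m * w m k :=
  rfl

theorem sumOperator_single [DecidableEq γ] (hw : RowSumsLE w C) (n : γ) :
    hw.sumOperator (lp.single ∞ n 1) = w n := by
  ext k
  simp [sumOperator_apply, Pi.single_apply]

theorem sumOperator_mem_of_mem_cZero {w : ℕ → ℓ^∞(ι, 𝕜)} (hw : RowSumsLE w C)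
    {M : Submodule 𝕜 ℓ^∞(ι, 𝕜)} (hM : IsClosed (M : Set ℓ^∞(ι, 𝕜))) (hwM : ∀ m, w m ∈ M)
    {a : EllInfty 𝕜} (ha : a ∈ cZero 𝕜) : hw.sumOperator a ∈ M := by
  have hsum : HasSum (fun m => a m • w m) (hw.sumOperator a) := by
    simpa [sumOperator_single] using (hasSum_smul_single ha).mapL hw.sumOperator
  exact hM.mem_of_tendsto hsum <| .of_forall fun F => M.sum_mem fun m _ => M.smul_mem _ (hwM m)

theorem sub_mul_norm_le_norm_sumOperator (hw : RowSumsLE w C) {d ε : ℝ} (hd : 0 < d) (hε : 0 ≤ ε)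
    (κ : γ → ι) (hdiag : ∀ n, d ≤ ‖w n (κ n)‖)
    (hoff : ∀ n (F : Finset γ), n ∉ F → ∑ m ∈ F, ‖w m (κ n)‖ ≤ ε) (a : ℓ^∞(γ, 𝕜)) :
    (d - ε) * ‖a‖ ≤ ‖hw.sumOperator a‖ := by
  have hcoord (n : γ) : ‖a n‖ * d ≤ ‖hw.sumOperator a‖ + ε * ‖a‖ :=
    calc ‖a n‖ * d ≤ ‖a n * w n (κ n)‖ := by
          rw [norm_mul]
          gcongr
          exact hdiag n
      _ ≤ ‖hw.sumOperator a (κ n)‖ + ‖hw.sumOperator a (κ n) - a n * w n (κ n)‖ :=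
          norm_le_norm_add_norm_sub _ _
      _ ≤ ‖hw.sumOperator a‖ + ε * ‖a‖ :=
          add_le_add (lp.norm_apply_le_norm ENNReal.top_ne_zero _ _)
            (norm_tsum_mul_sub_le (hw (κ n)) (hoff n) a)
  have hnorm : ‖a‖ ≤ (‖hw.sumOperator a‖ + ε * ‖a‖) / d :=
    lp.norm_le_of_forall_le (by positivity) fun n => (le_div_iff₀ hd).2 (hcoord n)
  rw [le_div_iff₀ hd] at hnorm
  linarith

theorem exists_embedding_antilipschitzWith_of_le_norm {w : ℕ → ℓ^∞(ι, 𝕜)} (hw : RowSumsLE w C)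
    {d : ℝ} (hd : 0 < d) (hwd : ∀ n, d ≤ ‖w n‖) :
    ∃ (f : ℕ ↪ ℕ) (K : ℝ≥0), AntilipschitzWith K (hw.comp_embedding f).sumOperator := by
  choose κ hκ using fun n =>
    exists_lt_norm_apply (half_pos hd).le ((half_lt_self hd).trans_le (hwd n))
  obtain ⟨K, hK⟩ := exists_nat_ge (C / (d / 4))
  obtain ⟨f, hf⟩ := exists_embedding_forall_offDiag_sum_le (by positivity : 0 ≤ d / 4) K
    (fun n m => ‖w m (κ n)‖)
    fun n F => (hw (κ n) F).trans ((div_le_iff₀ (by positivity)).1 hK)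
  refine ⟨f, (4 / d).toNNReal, ContinuousLinearMap.antilipschitz_of_bound _ fun a => ?_⟩
  have hlower := (hw.comp_embedding f).sub_mul_norm_le_norm_sumOperator (half_pos hd)
    (by positivity) (fun n => κ (f n)) (fun n => (hκ (f n)).le) hf a
  rw [Real.coe_toNNReal _ (by positivity), div_mul_eq_mul_div, le_div_iff₀ hd]
  linarith

theorem exists_embedding_antilipschitzWith (hw : RowSumsLE w C)
    (hw0 : ¬ Tendsto w cofinite (𝓝 0)) :
    ∃ (f : ℕ ↪ γ) (K : ℝ≥0), AntilipschitzWith K (hw.comp_embedding f).sumOperator := by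
  obtain ⟨d, hd, hinf⟩ : ∃ d > 0, {m | d ≤ ‖w m‖}.Infinite := by
    rw [NormedAddGroup.tendsto_nhds_zero] at hw0
    push Not at hw0
    simpa only [frequently_cofinite_iff_infinite] using hw0
  let g : ℕ ↪ γ := (hinf.natEmbedding _).trans (.subtype _)
  obtain ⟨f, K, hf⟩ := (hw.comp_embedding g).exists_embedding_antilipschitzWith_of_le_norm hd
    fun n => (hinf.natEmbedding _ n).2
  exact ⟨f.trans g, K, hf⟩

end RowSumsLE

end RowSums

end

/-! ### Copies of `c₀` in `ℓ^∞` -/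

theorem isClosed_of_continuousLinearEquiv {𝕜 E F : Type*} [Ring 𝕜]
    [NormedAddCommGroup E] [Module 𝕜 E] [NormedAddCommGroup F] [Module 𝕜 F]
    [CompleteSpace F] {M : Submodule 𝕜 E} (e : M ≃L[𝕜] F) : IsClosed (M : Set E) := by
  have : CompleteSpace M := (completeSpace_congr (e := e.toEquiv) e.isUniformEmbedding).2 ‹_›
  exact (completeSpace_coe_iff_isComplete.1 this).isClosed

theorem theorem18_general {𝕜 ι : Type*} [RCLike 𝕜] {M : Submodule 𝕜 ℓ^∞(ι, 𝕜)}
    (hM : IsClosed (M : Set ℓ^∞(ι, 𝕜))) (J : cZero 𝕜 →L[𝕜] M)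
    (hJ : ¬ Tendsto (fun n => J (cZero.single 𝕜 n)) atTop (𝓝 0)) :
    ∃ N H : Submodule 𝕜 ℓ^∞(ι, 𝕜),
      IsClosed (N : Set ℓ^∞(ι, 𝕜)) ∧ IsClosed (H : Set ℓ^∞(ι, 𝕜)) ∧
      N ≤ M ∧ N ≤ H ∧
      (∃ T : EllInfty 𝕜 ≃L[𝕜] H, ∃ S : cZero 𝕜 ≃L[𝕜] N,
        ∀ x : cZero 𝕜, (S x : ℓ^∞(ι, 𝕜)) = (T (x : EllInfty 𝕜) : ℓ^∞(ι, 𝕜))) ∧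
      HasNIP 𝕜 (H ⧸ N.submoduleOf H) := by
  have hw := rowSumsLE_map_single (M.subtypeL ∘L J)
  obtain ⟨f, K, hT⟩ := hw.exists_embedding_antilipschitzWith <| by
    rw [Nat.cofinite_eq_atTop]
    exact fun h => hJ (tendsto_subtype_rng.2 h)
  let T : EllInfty 𝕜 →L[𝕜] ℓ^∞(ι, 𝕜) := (hw.comp_embedding f).sumOperator
  let S : cZero 𝕜 →L[𝕜] ℓ^∞(ι, 𝕜) := T ∘L (cZero 𝕜).subtypeL
  have hS : AntilipschitzWith K S := fun x y => hT x y
  have hTc : IsClosed (Set.range T) := hT.isClosed_range T.uniformContinuous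
  have hSc : IsClosed (Set.range S) := hS.isClosed_range S.uniformContinuous
  have hTM (x : cZero 𝕜) : T x ∈ M :=
    (hw.comp_embedding f).sumOperator_mem_of_mem_cZero hM (fun m => (J _).2) x.2
  have hST (x : EllInfty 𝕜) : T x ∈ S.range ↔ x ∈ cZero 𝕜 :=
    ⟨fun ⟨y, hy⟩ => (hT.injective hy : (y : EllInfty 𝕜) = x) ▸ y.2, fun hx => ⟨⟨x, hx⟩, rfl⟩⟩
  refine ⟨S.range, T.range, hSc, hTc, ?_, ?_,
    ⟨T.equivRange hT.injective hTc, S.equivRange hS.injective hSc, fun _ => rfl⟩,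
    hasNIP_quotient_cZero.quotient_of_comap_eq (Q := S.range.submoduleOf T.range) T.rangeRestrict
      (Submodule.ext hST)⟩
  · rintro _ ⟨x, rfl⟩
    exact hTM x
  · rintro _ ⟨x, rfl⟩
    exact ⟨x, rfl⟩

theorem theorem18 (𝕜 : Type*) [RCLike 𝕜] (M : Submodule 𝕜 (EllInfty 𝕜))
    (hM : Nonempty (M ≃L[𝕜] cZero 𝕜)) :
    ∃ N H : Submodule 𝕜 (EllInfty 𝕜),
      IsClosed (N : Set (EllInfty 𝕜)) ∧ IsClosed (H : Set (EllInfty 𝕜)) ∧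
      N ≤ M ∧ N ≤ H ∧
      (∃ T : EllInfty 𝕜 ≃L[𝕜] H, ∃ S : cZero 𝕜 ≃L[𝕜] N,
        ∀ x : cZero 𝕜, (S x : EllInfty 𝕜) = (T (x : EllInfty 𝕜) : EllInfty 𝕜)) ∧
      HasNIP 𝕜 (H ⧸ N.submoduleOf H) := by
  obtain ⟨e⟩ := hM
  exact theorem18_general (isClosed_of_continuousLinearEquiv e) e.symm
    (not_tendsto_map_single e.symm)
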